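/- Notation. $\mathbb D$ is the open unit disk, $\mathbb T$ the unit circle with normalized Lebesgue measure $dm$. $H^\infty$ is the space of bounded analytic functions on $\mathbb D$ with the supremum norm, with its weak* topology as the dual of $L^1(\mathbb T)/H^1_0$, that is, the coarsest topology making $h\mapsto\int_{\mathbb T} f h\,dm$ continuous for every $f\in L^1(\mathbb T)$ (boundary values of $h$ are used in the integral). $\ell^\infty=(\ell^1)^*$ carries its usual weak* topology, and $\epsilon_n=(\delta_{n,j})_j\in\ell^\infty$. A sequence $(a_n)_{n\in\mathbb N}$ in $\mathbb T$ is separated if $\operatorname{dist}(a_n,\{a_j: j\ne n\})>0$ for every $n$ (the distance need not be bounded below uniformly in $n$). A sequence $(b_n)_{n\in\mathbb N}$ in $\mathbb D$ is interpolating if $h\mapsto (h(b_n))_n$ maps $H^\infty$ onto $\ell^\infty$; its Carleson constant is $\inf_k\prod_{j\ne k}\left|\frac{b_k-b_j}{1-\bar b_k b_j}\right|$. For such a sequence let $$B_k(z)=\prod_{n\neq k}\frac{|b_n|}{b_n}\,\frac{b_n-z}{1-\bar b_n z},\qquad g_k(z)=\frac{1-|b_k|^2}{1-\bar b_k z}\,\frac{B_k(z)}{B_k(b_k)}\qquad(z\in\mathbb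 D),$$ where a factor with $b_n=0$ is read as $z$. For a weak*-closed subspace $\mathcal E$ of $H^\infty$, a sequence $(x_n)$ in $\mathcal E$ is a w*-Schauder basis of $\mathcal E$ if every $x\in\mathcal E$ has a unique weak*-convergent expansion $x=\sum_n\alpha_n x_n$ with complex scalars $\alpha_n$; it is an $\ell^\infty$-basis of $\mathcal E$ if, moreover, there is a linear bijection $T:\ell^\infty\to\mathcal E$ with $T\epsilon_n=x_n$ for all $n$ which is an isomorphism for the norms and a homeomorphism for the weak* topologies (so that $\mathcal E$ is a weak*-copy of $\ell^\infty$). Theorem. Let $(a_n)_{n\in\mathbb N}$ be a separated sequence in $\mathbb T$ and let $0<m<1$. There are numbers $\eta_n>0$ such that every sequence $(b_n)_{n\in\mathbb N}$ in $\mathbb D$ with $|b_n-a_n|<\eta_n$ for all $n$ has the following properties. 1. $(b_n)$ is an interpolating sequence, with Carleson constant at least $m$. 2. The products $B_k(z)$ converge for all $k$ and all $z\in\mathbb D$, $B_k(b_k)\ne0$, the functions $g_k$ belong to $H^\infty$, and $(g_k)_k$ is an $\ell^\infty$-basis of the weak*-closed linear span $\mathcal E$ of $\{g_k : k\in\mathbb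 N\}$; in particular $\mathcal E$ is a weak*-copy of $\ell^\infty$. -/

import Mathlib

open Filter Topology MeasureTheory
open scoped ComplexConjugate ENNReal

noncomputable section

/-! ### The space `H^∞` and its weak* topology -/

/-- The open unit disk. -/
abbrev unitDisk : Set ℂ := Metric.ball (0 : ℂ) 1

/-- `H^∞`: the bounded analytic functions on the open unit disk. A function on the disk is
represented by its extension by `0` to `ℂ`, so that two elements of `HInfty` are equal exactly when
they agree on the disk. -/
def HInfty : Submodule ℂ (ℂ → ℂ) where
  carrier := {h | DifferentiableOn ℂ h unitDisk ∧ (∃ C : ℝ, ∀ z ∈ unitDisk, ‖h z‖ ≤ C) ∧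
    ∀ z, z ∉ unitDisk → h z = 0}
  zero_mem' := by
    refine ⟨differentiableOn_const 0, ⟨0, fun z _ => by simp⟩, fun z _ => rfl⟩
  add_mem' := by
    rintro f g ⟨hf, ⟨C, hC⟩, hf0⟩ ⟨hg, ⟨D, hD⟩, hg0⟩
    refine ⟨hf.add hg, ⟨C + D, fun z hz => ?_⟩, fun z hz => ?_⟩
    · exact (norm_add_le _ _).trans (add_le_add (hC z hz) (hD z hz))
    · simp [hf0 z hz, hg0 z hz]
  smul_mem' := by
    rintro c f ⟨hf, ⟨C, hC⟩, hf0⟩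
    refine ⟨hf.const_smul c, ⟨‖c‖ * C, fun z hz => ?_⟩, fun z hz => ?_⟩
    · simpa using mul_le_mul_of_nonneg_left (hC z hz) (norm_nonneg c)
    · simp [hf0 z hz]

/-- The norm of `H^∞`: the supremum of `|h|` over the disk. -/
def HInfty.supNorm (h : HInfty) : ℝ := ⨆ z : unitDisk, ‖(h : ℂ → ℂ) z‖

/-- If `h ∈ H^∞` has the radial boundary values `H` almost everywhere on `𝕋`, then the functional
given by `f ∈ L¹(𝕋)` takes at `h` the value `∫_𝕋 f H dm`. -/
theorem tendsto_circleAverage_mul_boundary (f : ℂ → ℂ) (hf : CircleIntegrable f 0 1) (h : HInfty)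
    (H : ℂ → ℂ)
    (hH : ∀ᵐ θ : ℝ, Tendsto (fun r : ℝ => (h : ℂ → ℂ) (r * circleMap 0 1 θ)) (𝓝[<] 1)
      (𝓝 (H (circleMap 0 1 θ)))) :
    Tendsto (fun r : ℝ => Real.circleAverage (fun w => f w * (h : ℂ → ℂ) (r * w)) 0 1)
      (𝓝[<] 1) (𝓝 (Real.circleAverage (fun w => f w * H w) 0 1)) := by
  obtain ⟨hd, ⟨C, hC⟩, h0⟩ := h.2
  have hmem : ∀ᶠ r : ℝ in 𝓝[<] 1, r ∈ Set.Ioo (0 : ℝ) 1 := Ioo_mem_nhdsLT one_pos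
  have hdisk : ∀ r ∈ Set.Ioo (0 : ℝ) 1, ∀ θ : ℝ, (r : ℂ) * circleMap 0 1 θ ∈ unitDisk := by
    intro r hr θ
    simp [abs_of_pos hr.1, hr.2]
  have hfm : AEStronglyMeasurable (fun θ : ℝ => f (circleMap 0 1 θ))
      (volume.restrict (Set.uIoc 0 (2 * Real.pi))) := hf.def'.aestronglyMeasurable
  unfold Real.circleAverage
  refine Tendsto.const_smul ?_ _
  refine intervalIntegral.tendsto_integral_filter_of_dominated_convergence
    (fun θ => ‖f (circleMap 0 1 θ)‖ * C) ?_ ?_ ?_ ?_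
  · filter_upwards [hmem] with r hr
    refine hfm.mul ?_
    refine Continuous.aestronglyMeasurable ?_
    exact hd.continuousOn.comp_continuous (by fun_prop) (hdisk r hr)
  · filter_upwards [hmem] with r hr
    refine Eventually.of_forall fun θ _ => ?_
    rw [norm_mul]
    exact mul_le_mul_of_nonneg_left (hC _ (hdisk r hr θ)) (norm_nonneg _)
  · exact hf.norm.mul_const C
  · filter_upwards [hH] with θ hθ _
    exact hθ.const_mul _

/-- `φ : H^∞ → ℂ` is the functional `h ↦ ⟨[f], h⟩ = ∫_𝕋 f h dm` given by some `f ∈ L¹(𝕋)`, where `m`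
is the normalized Lebesgue measure of the unit circle `𝕋`. Since the dilates `h_r(w) = h(r w)` of
`h ∈ H^∞` are uniformly bounded and converge almost everywhere on `𝕋` to the boundary function of
`h` as `r → 1-`, the integral of `f` against the boundary function is the limit of the integrals
`∫_𝕋 f h_r dm` (see `tendsto_circleAverage_mul_boundary`). -/
def IsPredualFunctional (φ : HInfty → ℂ) : Prop :=
  ∃ f : ℂ → ℂ, CircleIntegrable f 0 1 ∧ ∀ h : HInfty,
    Tendsto (fun r : ℝ => Real.circleAverage (fun w => f w * (h : ℂ → ℂ) (r * w)) 0 1)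
      (𝓝[<] 1) (𝓝 (φ h))

/-- The weak* topology of `H^∞ = (L¹/H¹₀)*`: the coarsest topology that makes the functionals
`h ↦ ∫_𝕋 f h dm`, `f ∈ L¹(𝕋)`, continuous. -/
abbrev HInfty.weakStar : TopologicalSpace HInfty :=
  ⨅ (φ : HInfty → ℂ) (_ : IsPredualFunctional φ), TopologicalSpace.induced φ inferInstance

/-! ### The space `ℓ^∞` and its weak* topology -/

/-- The Banach space `ℓ^∞` of bounded complex sequences. -/
abbrev LInfty : Type := lp (fun _ : ℕ => ℂ) ∞

/-- The weak* topology of `ℓ^∞ = (ℓ¹)*`. -/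
abbrev LInfty.weakStar : TopologicalSpace LInfty :=
  ⨅ a : lp (fun _ : ℕ => ℂ) 1,
    TopologicalSpace.induced (fun c : LInfty => ∑' n, a n * c n) inferInstance

/-- The canonical sequence `ε_n` in `ℓ^∞`. -/
def LInfty.eps (n : ℕ) : LInfty := lp.single ∞ n (1 : ℂ)

/-! ### `ℓ^∞`-bases -/

/-- `g` is a w*-Schauder basis of the subspace `E` of `H^∞`: its terms lie in `E` and every `x ∈ E`
has a unique weak*-convergent expansion `x = ∑ₙ αₙ gₙ`. -/
def IsWeakStarSchauderBasis (E : Submodule ℂ HInfty) (g : ℕ → HInfty) : Prop :=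
  (∀ n, g n ∈ E) ∧ ∀ x ∈ E, ∃! α : ℕ → ℂ,
    Tendsto (fun N => ∑ n ∈ Finset.range N, α n • g n) atTop (@nhds HInfty HInfty.weakStar x)

/-- The topology induced on a subspace of `H^∞` by the weak* topology. -/
abbrev weakStarOn (E : Submodule ℂ HInfty) : TopologicalSpace E :=
  TopologicalSpace.induced (Subtype.val : E → HInfty) HInfty.weakStar

/-- `T` is an isomorphism of `ℓ^∞` onto the subspace `E` of `H^∞`, for the norms as well as for the
weak* topologies; when `E` is weak*-closed, this says that `E` is a weak*-copy of `ℓ^∞`, via `T`. -/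
structure IsWeakStarIsomorphism {E : Submodule ℂ HInfty} (T : LInfty ≃ₗ[ℂ] E) : Prop where
  bounded : ∃ C : ℝ, ∀ c, HInfty.supNorm (T c) ≤ C * ‖c‖
  bounded_below : ∃ C : ℝ, ∀ c, ‖c‖ ≤ C * HInfty.supNorm (T c)
  weakStar_continuous : Continuous[LInfty.weakStar, weakStarOn E] T
  weakStar_continuous_symm : Continuous[weakStarOn E, LInfty.weakStar] T.symm

/-- `g` is an `ℓ^∞`-basis of the subspace `E` of `H^∞`: a w*-Schauder basis of `E` which is
w*-equivalent to the canonical sequence of `ℓ^∞`. -/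
def IsLInftyBasis (E : Submodule ℂ HInfty) (g : ℕ → HInfty) : Prop :=
  IsWeakStarSchauderBasis E g ∧ ∃ T : LInfty ≃ₗ[ℂ] E,
    IsWeakStarIsomorphism T ∧ ∀ n, (T (LInfty.eps n) : HInfty) = g n

/-! ### Separated and interpolating sequences, Blaschke products -/

/-- A sequence is separated if each of its terms has a positive distance to the set of all the
others. -/
def IsSeparatedSeq (a : ℕ → ℂ) : Prop :=
  ∀ n, ∃ δ > 0, ∀ j, j ≠ n → δ ≤ dist (a n) (a j)

/-- A sequence in the disk is interpolating if `h ↦ (h (b n))ₙ` maps `H^∞` onto `ℓ^∞`. -/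
def IsInterpolating (b : ℕ → ℂ) : Prop :=
  (∀ n, b n ∈ unitDisk) ∧ ∀ c : LInfty, ∃ h : HInfty, ∀ n, (h : ℂ → ℂ) (b n) = c n

/-- The Carleson constant `inf_k ∏_{j ≠ k} |(b_k - b_j) / (1 - conj b_k * b_j)|`. (For a sequence in
the disk all factors lie in `[0, 1)`, so the infinite products exist.) -/
def carlesonConstant (b : ℕ → ℂ) : ℝ :=
  ⨅ k : ℕ, ∏' j : {j : ℕ // j ≠ k}, ‖(b k - b j) / (1 - conj (b k) * b j)‖

/-- The Blaschke factor with zero `b`, with the usual unimodular normalization (which is what makes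
infinite Blaschke products converge). -/
def blaschkeFactor (b z : ℂ) : ℂ :=
  if b = 0 then z else (‖b‖ / b) * ((b - z) / (1 - conj b * z))

/-- The Blaschke product `B_k` with zeros `b_n`, `n ≠ k`. -/
def blaschkeProd (b : ℕ → ℂ) (k : ℕ) (z : ℂ) : ℂ :=
  ∏' n : {n : ℕ // n ≠ k}, blaschkeFactor (b n) z

/-- The function `g_k(z) = (1 - |b_k|²) / (1 - conj b_k * z) * (B_k(z) / B_k(b_k))`. -/
def gFun (b : ℕ → ℂ) (k : ℕ) (z : ℂ) : ℂ :=
  (1 - (‖b k‖ : ℂ) ^ 2) / (1 - conj (b k) * z) * (blaschkeProd b k z / blaschkeProd b k (b k))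

end

noncomputable section

/-! ### Circle averages of series -/

/-! Let `δ n` be a separation distance of `a n` and let `b n` lie within `δ n * τ n` of `a n`, with
`τ` small and geometric. The pseudohyperbolic distance of `b k` and `b j` then differs from 1 by at
most `16 * τ k * τ j` (`one_sub_pseudohyperbolic_le`), so summing over `j` keeps every `|B_k(b_k)|`
above `m`.

On the radius ending at `w ∈ 𝕋`, the factor `(1 - |b_k|²) / (1 - conj b_k * z)` is at most 2, and at
most `16 * τ k` unless `w` is within `δ k / 2` of `a k`. Such neighbourhoods of different points are
disjoint, so `∑ₖ |g_k|` has a majorant with bounded sums that does not depend on the position on the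
radius (`isDominatedSystem_gHInfty`).

The rest is duality. Synthesis `c ↦ ∑ₖ cₖ gₖ` is bounded from `ℓ^∞` to `H^∞`, and sampling at the
points `b n` is a left inverse because `g_k(b_n)` is 1 for `n = k` and 0 otherwise; this already
solves the interpolation problem. Both maps are weak* continuous: sampling is the adjoint of `A ↦ ∑
A_n P_{b_n}` with Poisson kernels `P_{b_n}` (`isPredualFunctional_tsum_eval`), synthesis that of `f
↦ (∫ f g_k dm)_k`, which takes values in `ℓ¹` by the domination (`predual_synthesis`). Hence the
range of synthesis is weak*-closed, is the closed span of the `g_k`, and is a weak*-copy of `ℓ^∞`.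
-/

theorem circleIntegrable_iff_integrableOn {E : Type*} [NormedAddCommGroup E] (f : ℂ → E) :
    CircleIntegrable f 0 1 ↔
      Integrable (fun θ : ℝ => f (circleMap 0 1 θ))
        (volume.restrict (Set.Ioc 0 (2 * Real.pi))) :=
  intervalIntegrable_iff_integrableOn_Ioc_of_le Real.two_pi_pos.le

theorem circleAverage_eq_setIntegral {E : Type*} [NormedAddCommGroup E] [NormedSpace ℝ E]
    (f : ℂ → E) :
    Real.circleAverage f 0 1 =
      (2 * Real.pi)⁻¹ • ∫ θ in Set.Ioc 0 (2 * Real.pi), f (circleMap 0 1 θ) := by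
  rw [Real.circleAverage_def, intervalIntegral.integral_of_le Real.two_pi_pos.le]

theorem norm_circleAverage_le {f : ℂ → ℂ} :
    ‖Real.circleAverage f 0 1‖ ≤ Real.circleAverage (fun w => ‖f w‖) 0 1 := by
  rw [circleAverage_eq_setIntegral, circleAverage_eq_setIntegral, norm_smul, smul_eq_mul,
    Real.norm_of_nonneg (by positivity)]
  gcongr
  exact norm_integral_le_integral_norm _

/-- A series of integrable functions with summable `L¹` norms has an integrable sum. -/
theorem integrable_tsum_of_summable_integral_norm {X : Type*} [MeasurableSpace X] {μ : Measure X}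
    {F : ℕ → X → ℂ} (hF : ∀ n, Integrable (F n) μ)
    (hs : Summable fun n => ∫ x, ‖F n x‖ ∂μ) : Integrable (fun x => ∑' n, F n x) μ := by
  have hl : ∑' n, ∫⁻ x, ‖F n x‖ₑ ∂μ ≠ ∞ := by
    have h1 : ∀ n, ∫⁻ x, ‖F n x‖ₑ ∂μ = ENNReal.ofReal (∫ x, ‖F n x‖ ∂μ) := fun n =>
      (ofReal_integral_norm_eq_lintegral_enorm (hF n)).symm
    simp_rw [h1]
    exact hs.tsum_ofReal_ne_top
  have hae : ∀ᵐ x ∂μ, Summable fun n => ‖F n x‖ := by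
    refine summable_norm_of_tsum_eLpNorm_ne_top le_rfl (fun n => (hF n).1) ?_
    simpa only [eLpNorm_one_eq_lintegral_enorm] using hl
  refine ⟨aestronglyMeasurable_of_tendsto_ae atTop
    (f := fun N x => ∑ n ∈ Finset.range N, F n x)
    (fun N => Finset.aestronglyMeasurable_fun_sum _ fun n _ => (hF n).1) ?_, ?_⟩
  · filter_upwards [hae] with x hx
    exact hx.of_norm.hasSum.tendsto_sum_nat
  · refine lt_of_le_of_lt (lintegral_mono fun x => enorm_tsum_le_tsum_enorm) ?_
    rw [lintegral_tsum fun n => (hF n).1.enorm]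
    exact hl.lt_top

theorem summable_integral_norm_of_summable_circleAverage {F : ℕ → ℂ → ℂ}
    (hs : Summable fun n => Real.circleAverage (fun w => ‖F n w‖) 0 1) :
    Summable fun n => ∫ θ in Set.Ioc 0 (2 * Real.pi), ‖F n (circleMap 0 1 θ)‖ := by
  have := hs.mul_left (2 * Real.pi)
  refine this.congr fun n => ?_
  rw [circleAverage_eq_setIntegral, smul_eq_mul, ← mul_assoc,
    mul_inv_cancel₀ Real.two_pi_pos.ne', one_mul]

theorem circleIntegrable_tsum {F : ℕ → ℂ → ℂ} (hF : ∀ n, CircleIntegrable (F n) 0 1)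
    (hs : Summable fun n => Real.circleAverage (fun w => ‖F n w‖) 0 1) :
    CircleIntegrable (fun w => ∑' n, F n w) 0 1 := by
  rw [circleIntegrable_iff_integrableOn]
  exact integrable_tsum_of_summable_integral_norm
    (fun n => (circleIntegrable_iff_integrableOn _).1 (hF n))
    (summable_integral_norm_of_summable_circleAverage hs)

theorem circleAverage_tsum {F : ℕ → ℂ → ℂ} (hF : ∀ n, CircleIntegrable (F n) 0 1)
    (hs : Summable fun n => Real.circleAverage (fun w => ‖F n w‖) 0 1) :
    Real.circleAverage (fun w => ∑' n, F n w) 0 1 = ∑' n, Real.circleAverage (F n) 0 1 := by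
  have := hasSum_integral_of_summable_integral_norm
    (fun n => (circleIntegrable_iff_integrableOn _).1 (hF n))
    (summable_integral_norm_of_summable_circleAverage hs)
  simp_rw [circleAverage_eq_setIntegral]
  exact (this.const_smul _).tsum_eq.symm

/-! ### Weak* continuous functionals -/

theorem norm_ofReal_mul_lt_one {r : ℝ} (hr : r ∈ Set.Ico (0 : ℝ) 1) {w : ℂ} (hw : ‖w‖ = 1) :
    (r : ℂ) * w ∈ unitDisk := by
  simp [hw, abs_of_nonneg hr.1, hr.2]

theorem eventually_mem_Ico : ∀ᶠ r : ℝ in 𝓝[<] 1, r ∈ Set.Ico (0 : ℝ) 1 :=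
  Ico_mem_nhdsLT one_pos

namespace HInfty

theorem continuousOn_dilate (h : HInfty) {r : ℝ} (hr : r ∈ Set.Ico (0 : ℝ) 1) :
    ContinuousOn (fun w : ℂ => (h : ℂ → ℂ) (r * w)) (Metric.sphere 0 |1|) :=
  h.2.1.continuousOn.comp (by fun_prop) fun w hw =>
    norm_ofReal_mul_lt_one hr (by simpa using hw)

theorem circleIntegrable_mul_dilate (h : HInfty) {r : ℝ} (hr : r ∈ Set.Ico (0 : ℝ) 1)
    {f : ℂ → ℂ} (hf : CircleIntegrable f 0 1) :
    CircleIntegrable (fun w => f w * (h : ℂ → ℂ) (r * w)) 0 1 := by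
  exact hf.fun_smul_continuousOn (continuousOn_dilate h hr)

theorem continuous_of_isPredualFunctional {φ : HInfty → ℂ} (hφ : IsPredualFunctional φ) :
    Continuous[HInfty.weakStar, inferInstance] φ :=
  continuous_iInf_dom (i := φ) (continuous_iInf_dom (i := hφ) continuous_induced_dom)

/-- For `r < 1` the dilate is continuous up to the circle, so the Poisson formula applies without
boundary values of `h`. -/
theorem circleAverage_poissonKernel_dilate (h : HInfty) {b : ℂ} (hb : b ∈ unitDisk) {r : ℝ}
    (hr : r ∈ Set.Ico (0 : ℝ) 1) :
    Real.circleAverage (fun w => (poissonKernel 0 b w : ℂ) * (h : ℂ → ℂ) (r * w)) 0 1 =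
      (h : ℂ → ℂ) (r * b) := by
  have hd : DiffContOnCl ℂ (fun w : ℂ => (h : ℂ → ℂ) (r * w)) (Metric.ball 0 1) := by
    refine DifferentiableOn.diffContOnCl ?_
    rw [closure_ball _ one_ne_zero]
    refine h.2.1.comp (by fun_prop) fun w hw => ?_
    have : ‖w‖ ≤ 1 := by simpa using hw
    have h2 : r * ‖w‖ ≤ r * 1 := by have := hr.1; gcongr
    simp [abs_of_nonneg hr.1]
    linarith [hr.2]
  simpa [Pi.smul_def'] using hd.circleAverage_poissonKernel_smul hb

theorem continuousOn_poissonKernel {b : ℂ} (hb : b ∈ unitDisk) :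
    ContinuousOn (poissonKernel 0 b) (Metric.sphere 0 |1|) := by
  rw [poissonKernel_eq_re_herglotzRieszKernel]
  exact Complex.continuous_re.comp_continuousOn (continuousOn_herglotzRieszKernel_sphere hb)

theorem poissonKernel_nonneg {b w : ℂ} (hb : b ∈ unitDisk) (hw : ‖w‖ = 1) :
    0 ≤ poissonKernel 0 b w := by
  rw [poissonKernel_def]
  have : ‖b‖ < 1 := by simpa using hb
  refine div_nonneg ?_ (by positivity)
  simp only [sub_zero, hw]
  nlinarith [norm_nonneg b]

theorem circleAverage_poissonKernel {b : ℂ} (hb : b ∈ unitDisk) :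
    Real.circleAverage (poissonKernel 0 b) 0 1 = 1 := by
  have h := (diffContOnCl_const (𝕜 := ℂ) (c := (1 : ℂ)) (s := Metric.ball (0 : ℂ) 1))
    |>.circleAverage_poissonKernel_smul hb
  have h2 := Complex.ofRealCLM.circleAverage_comp_comm
    (f := poissonKernel 0 b) (c := 0) (R := 1)
    (continuousOn_poissonKernel hb).circleIntegrable'
  rw [← Complex.ofReal_inj]
  refine Eq.trans h2.symm (Eq.trans ?_ h)
  congr 1
  ext w
  simp

/-- A weak* continuous functional: an `ℓ¹` combination of point evaluations. -/
theorem isPredualFunctional_tsum_eval {b : ℕ → ℂ} (hb : ∀ n, b n ∈ unitDisk)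
    {A : ℕ → ℂ} (hA : Summable fun n => ‖A n‖) :
    IsPredualFunctional fun h => ∑' n, A n * (h : ℂ → ℂ) (b n) := by
  have hP : ∀ n, CircleIntegrable (fun w => A n * (poissonKernel 0 (b n) w : ℂ)) 0 1 := by
    intro n
    refine ContinuousOn.circleIntegrable' ?_
    exact continuousOn_const.mul
      (Complex.continuous_ofReal.comp_continuousOn (continuousOn_poissonKernel (hb n)))
  have hav : ∀ n, Real.circleAverage (fun w => ‖A n * (poissonKernel 0 (b n) w : ℂ)‖) 0 1
      = ‖A n‖ := by
    intro n
    have h1 : Set.EqOn (fun w => ‖A n * (poissonKernel 0 (b n) w : ℂ)‖)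
        (fun w => ‖A n‖ • poissonKernel 0 (b n) w) (Metric.sphere 0 |1|) := by
      intro w hw
      simp [abs_of_nonneg (poissonKernel_nonneg (hb n) (w := w) (by simpa using hw))]
    rw [Real.circleAverage_congr_sphere h1, Real.circleAverage_fun_smul,
      circleAverage_poissonKernel (hb n)]
    simp
  -- Each Poisson kernel is nonnegative with mean 1, so this series converges in `L¹`.
  refine ⟨fun w => ∑' n, A n * (poissonKernel 0 (b n) w : ℂ),
    circleIntegrable_tsum hP (by simpa only [hav] using hA), fun h => ?_⟩
  obtain ⟨C, hC⟩ := h.2.2.1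
  have key : ∀ᶠ r : ℝ in 𝓝[<] 1, ∑' n, A n * (h : ℂ → ℂ) (r * b n) =
      Real.circleAverage (fun w => (∑' n, A n * (poissonKernel 0 (b n) w : ℂ)) *
        (h : ℂ → ℂ) (r * w)) 0 1 := by
    filter_upwards [eventually_mem_Ico] with r hr
    simp_rw [← tsum_mul_right]
    rw [circleAverage_tsum]
    · congr 1
      ext n
      simp_rw [mul_assoc]
      rw [← circleAverage_poissonKernel_dilate h (hb n) hr, ← smul_eq_mul,
        ← Real.circleAverage_fun_smul]
      rfl
    · exact fun n => circleIntegrable_mul_dilate h hr (hP n)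
    · refine (hA.mul_right C).of_nonneg_of_le
        (fun n => Real.circleAverage_nonneg_of_nonneg fun _ _ => norm_nonneg _) fun n => ?_
      rw [← hav n, mul_comm, ← smul_eq_mul, ← Real.circleAverage_fun_smul]
      refine Real.circleAverage_mono (circleIntegrable_mul_dilate h hr (hP n)).norm
        (IntervalIntegrable.const_mul (hP n).norm _) fun w hw => ?_
      rw [norm_mul, smul_eq_mul, mul_comm]
      gcongr
      exact hC _ (norm_ofReal_mul_lt_one hr (by simpa using hw))
  refine Tendsto.congr' key ?_
  -- Let `r → 1` term by term: `h` is continuous at `b n`, and `‖A n‖ * C` dominates.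
  refine tendsto_tsum_of_dominated_convergence (hA.mul_right C) (fun n => ?_) ?_
  · refine Tendsto.const_mul _ ?_
    have hc : ContinuousAt (h : ℂ → ℂ) (b n) :=
      h.2.1.continuousOn.continuousAt (Metric.isOpen_ball.mem_nhds (hb n))
    refine hc.tendsto.comp ?_
    have : Tendsto (fun r : ℝ => (r : ℂ) * b n) (𝓝 1) (𝓝 (((1 : ℝ) : ℂ) * b n)) :=
      Continuous.tendsto (by fun_prop) 1
    simpa using this.mono_left nhdsWithin_le_nhds
  · filter_upwards [eventually_mem_Ico] with r hr n
    rw [norm_mul]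
    gcongr
    refine hC _ ?_
    have h1 : ‖b n‖ < 1 := by simpa using hb n
    have h2 : r * ‖b n‖ ≤ 1 * ‖b n‖ := by have := hr.2.le; gcongr
    simp [abs_of_nonneg hr.1]
    linarith

theorem isPredualFunctional_eval {z : ℂ} (hz : z ∈ unitDisk) :
    IsPredualFunctional fun h => (h : ℂ → ℂ) z := by
  have := isPredualFunctional_tsum_eval (b := fun _ => z) (fun _ => hz)
    (A := fun n => if n = 0 then 1 else 0)
    (summable_of_ne_finset_zero (s := {0}) (by intro n hn; simp at hn; simp [hn]))
  simpa [ite_mul] using this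

end HInfty

/-! ### Sequences of `H^∞` which are dominated and biorthogonal to point evaluations -/

/-- The functions `g k` form a biorthogonal system with the evaluations at the points `b n`, and
`∑ₖ |g k|` is dominated, on all radii ending at `w ∈ 𝕋`, by a series with bounded sums. -/
structure IsDominatedSystem (b : ℕ → ℂ) (g : ℕ → HInfty) (u : ℕ → ℂ → ℝ) (M : ℝ) : Prop where
  mem_disk : ∀ n, b n ∈ unitDisk
  biorthogonal : ∀ k n, (g k : ℂ → ℂ) (b n) = if n = k then 1 else 0
  measurable : ∀ k, Measurable (u k)
  -- The bound is independent of `r`, which permits dominated convergence as `r → 1`.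
  norm_le : ∀ k w, ‖w‖ = 1 → ∀ r ∈ Set.Ico (0 : ℝ) 1, ‖(g k : ℂ → ℂ) (r * w)‖ ≤ u k w
  sum_le : ∀ w, ‖w‖ = 1 → ∀ s : Finset ℕ, ∑ k ∈ s, u k w ≤ M
  -- A Weierstrass test on smaller disks, which makes the series `∑ₖ cₖ gₖ` analytic.
  exists_summable : ∀ ρ < (1 : ℝ), ∃ v : ℕ → ℝ, Summable v ∧
    ∀ k, ∀ z ∈ Metric.ball (0 : ℂ) ρ, ‖(g k : ℂ → ℂ) z‖ ≤ v k

theorem LInfty.norm_apply_le (c : LInfty) (n : ℕ) : ‖c n‖ ≤ ‖c‖ :=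
  lp.norm_apply_le_norm ENNReal.top_ne_zero c n

theorem LInfty.summable_mul {A : ℕ → ℂ} (hA : Summable fun n => ‖A n‖) (c : LInfty) :
    Summable fun n => A n * c n := by
  refine (hA.mul_right ‖c‖).of_norm_bounded fun n => ?_
  rw [norm_mul]
  gcongr
  exact c.norm_apply_le n

theorem LInfty.continuous_tsum_mul {A : ℕ → ℂ} (hA : Summable fun n => ‖A n‖) :
    Continuous[LInfty.weakStar, inferInstance] fun c : LInfty => ∑' n, A n * c n := by
  have hm : Memℓp A 1 := memℓp_gen (by simpa using hA)
  exact continuous_iInf_dom (i := (⟨A, hm⟩ : lp (fun _ : ℕ => ℂ) 1)) continuous_induced_dom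

theorem LInfty.summable_norm (A : lp (fun _ : ℕ => ℂ) 1) : Summable fun n => ‖A n‖ := by
  simpa using (lp.memℓp A).summable (by simp)

/-! ### Sampling, the Hausdorff property and the supremum norm -/

namespace HInfty

/-- The sequence of the values of `h ∈ H^∞` at given points of the disk. -/
def sample (b : ℕ → ℂ) (hb : ∀ n, b n ∈ unitDisk) : HInfty →ₗ[ℂ] LInfty where
  toFun h := ⟨fun n => (h : ℂ → ℂ) (b n), memℓp_infty <| by
    obtain ⟨C, hC⟩ := h.2.2.1
    exact ⟨C, by rintro _ ⟨n, rfl⟩; exact hC _ (hb n)⟩⟩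
  map_add' _ _ := rfl
  map_smul' _ _ := rfl

theorem continuous_sample (b : ℕ → ℂ) (hb : ∀ n, b n ∈ unitDisk) :
    Continuous[HInfty.weakStar, LInfty.weakStar] (sample b hb) :=
  continuous_iInf_rng.2 fun A => continuous_induced_rng.2 <|
    continuous_of_isPredualFunctional (isPredualFunctional_tsum_eval hb (LInfty.summable_norm A))

/-- Point evaluations in the disk are weak* continuous, and they separate elements because all of
these vanish off the disk. -/
theorem t2Space_weakStar : @T2Space HInfty HInfty.weakStar := by
  let := HInfty.weakStar
  refine ⟨fun x y hxy => ?_⟩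
  obtain ⟨z, hz⟩ : ∃ z, (x : ℂ → ℂ) z ≠ (y : ℂ → ℂ) z := by
    by_contra! h
    exact hxy (Subtype.ext (funext h))
  have hzd : z ∈ unitDisk := by
    by_contra hz'
    exact hz (by rw [x.2.2.2 z hz', y.2.2.2 z hz'])
  exact separated_by_continuous
    (continuous_of_isPredualFunctional (isPredualFunctional_eval hzd)) hz

theorem bddAbove_norm (h : HInfty) : BddAbove (Set.range fun z : unitDisk => ‖(h : ℂ → ℂ) z‖) := by
  obtain ⟨C, hC⟩ := h.2.2.1
  exact ⟨C, by rintro _ ⟨z, rfl⟩; exact hC z z.2⟩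

theorem norm_apply_le_supNorm (h : HInfty) {z : ℂ} (hz : z ∈ unitDisk) :
    ‖(h : ℂ → ℂ) z‖ ≤ supNorm h :=
  le_ciSup (bddAbove_norm h) ⟨z, hz⟩

theorem supNorm_le (h : HInfty) {C : ℝ} (hC : ∀ z ∈ unitDisk, ‖(h : ℂ → ℂ) z‖ ≤ C) :
    supNorm h ≤ C :=
  haveI : Nonempty unitDisk := ⟨⟨0, by simp⟩⟩
  ciSup_le fun z => hC z z.2

end HInfty

/-! ### The synthesis operator and its weak* continuity -/

namespace IsDominatedSystem

open HInfty

variable {b : ℕ → ℂ} {g : ℕ → HInfty} {u : ℕ → ℂ → ℝ} {M : ℝ}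

theorem nonneg (hg : IsDominatedSystem b g u M) (k : ℕ) {w : ℂ} (hw : ‖w‖ = 1) : 0 ≤ u k w :=
  (norm_nonneg _).trans (hg.norm_le k w hw 0 (by simp))

theorem bound_le (hg : IsDominatedSystem b g u M) (k : ℕ) {w : ℂ} (hw : ‖w‖ = 1) : u k w ≤ M := by
  simpa using hg.sum_le w hw {k}

theorem sum_norm_le (hg : IsDominatedSystem b g u M) {z : ℂ} (hz : z ∈ unitDisk) (s : Finset ℕ) :
    ∑ k ∈ s, ‖(g k : ℂ → ℂ) z‖ ≤ M := by
  have hz1 : ‖z‖ < 1 := by simpa using hz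
  obtain ⟨w, hw, hwz⟩ : ∃ w : ℂ, ‖w‖ = 1 ∧ z = (‖z‖ : ℂ) * w := by
    rcases eq_or_ne z 0 with rfl | h0
    · exact ⟨1, by simp, by simp⟩
    · have : (‖z‖ : ℂ) ≠ 0 := by simpa using h0
      exact ⟨z / ‖z‖, by simp [h0], by field_simp⟩
  refine (Finset.sum_le_sum fun k _ => ?_).trans (hg.sum_le w hw s)
  rw [hwz]
  exact hg.norm_le k w hw _ ⟨norm_nonneg z, hz1⟩

theorem summable_norm (hg : IsDominatedSystem b g u M) {z : ℂ} (hz : z ∈ unitDisk) :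
    Summable fun k => ‖(g k : ℂ → ℂ) z‖ :=
  summable_of_sum_le (fun _ => norm_nonneg _) (hg.sum_norm_le hz)

theorem summable_mul (hg : IsDominatedSystem b g u M) (c : LInfty) {z : ℂ} (hz : z ∈ unitDisk) :
    Summable fun k => (g k : ℂ → ℂ) z * c k :=
  c.summable_mul (hg.summable_norm hz)

theorem norm_tsum_le (hg : IsDominatedSystem b g u M) (c : LInfty) {z : ℂ} (hz : z ∈ unitDisk) :
    ‖∑' k, (g k : ℂ → ℂ) z * c k‖ ≤ M * ‖c‖ := by
  have h1 := tsum_of_norm_bounded (f := fun k => (g k : ℂ → ℂ) z * c k)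
    ((hg.summable_norm hz).mul_right ‖c‖).hasSum fun k => by
      rw [norm_mul]
      gcongr
      exact c.norm_apply_le k
  rw [tsum_mul_right] at h1
  refine h1.trans ?_
  gcongr
  exact (hg.summable_norm hz).tsum_le_of_sum_le (hg.sum_norm_le hz)

theorem differentiableOn_tsum (hg : IsDominatedSystem b g u M) (c : LInfty) :
    DifferentiableOn ℂ (fun z => ∑' k, (g k : ℂ → ℂ) z * c k) unitDisk := by
  intro z hz
  have hz1 : ‖z‖ < 1 := by simpa using hz
  obtain ⟨ρ, hzρ, hρ⟩ := exists_between hz1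
  obtain ⟨v, hv, hgv⟩ := hg.exists_summable ρ hρ
  have hsub : Metric.ball (0 : ℂ) ρ ⊆ unitDisk := Metric.ball_subset_ball hρ.le
  have := Complex.differentiableOn_tsum_of_summable_norm (hv.mul_right ‖c‖)
    (F := fun k z => (g k : ℂ → ℂ) z * c k) (U := Metric.ball (0 : ℂ) ρ)
    (fun k => ((g k).2.1.mono hsub).mul_const _) Metric.isOpen_ball fun k w hw => by
      rw [norm_mul]
      gcongr
      · exact (norm_nonneg _).trans (hgv k w hw)
      · exact hgv k w hw
      · exact c.norm_apply_le k
  have hzb : Metric.ball (0 : ℂ) ρ ∈ 𝓝 z := Metric.isOpen_ball.mem_nhds (by simpa using hzρ)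
  exact (this.differentiableAt hzb).differentiableWithinAt

/-- The operator `c ↦ ∑ₖ cₖ gₖ` from `ℓ^∞` to `H^∞`. -/
def synthesis (hg : IsDominatedSystem b g u M) : LInfty →ₗ[ℂ] HInfty where
  toFun c := ⟨unitDisk.indicator fun z => ∑' k, (g k : ℂ → ℂ) z * c k,
    (hg.differentiableOn_tsum c).congr fun z hz => Set.indicator_of_mem hz _,
    ⟨M * ‖c‖, fun z hz => by
      rw [Set.indicator_of_mem hz]
      exact hg.norm_tsum_le c hz⟩,
    fun z hz => Set.indicator_of_notMem hz _⟩
  map_add' c d := by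
    ext z
    by_cases hz : z ∈ unitDisk
    · have := (hg.summable_mul c hz).tsum_add (hg.summable_mul d hz)
      simpa [Set.indicator_of_mem hz, mul_add] using this
    · simp [Set.indicator_of_notMem hz]
  map_smul' a c := by
    ext z
    by_cases hz : z ∈ unitDisk
    · have := tsum_mul_left (L := .unconditional ℕ) (a := a) (f := fun k => (g k : ℂ → ℂ) z * c k)
      simpa [Set.indicator_of_mem hz, mul_left_comm] using this
    · simp [Set.indicator_of_notMem hz]

theorem synthesis_apply (hg : IsDominatedSystem b g u M) (c : LInfty) {z : ℂ}
    (hz : z ∈ unitDisk) : (hg.synthesis c : ℂ → ℂ) z = ∑' k, (g k : ℂ → ℂ) z * c k :=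
  Set.indicator_of_mem hz fun z => ∑' k, (g k : ℂ → ℂ) z * c k

theorem synthesis_apply_point (hg : IsDominatedSystem b g u M) (c : LInfty) (n : ℕ) :
    (hg.synthesis c : ℂ → ℂ) (b n) = c n := by
  rw [hg.synthesis_apply c (hg.mem_disk n), tsum_eq_single n]
  · simp [hg.biorthogonal]
  · intro k hk
    simp [hg.biorthogonal, hk.symm]

theorem sample_synthesis (hg : IsDominatedSystem b g u M) (c : LInfty) :
    sample b hg.mem_disk (hg.synthesis c) = c :=
  lp.ext (funext (hg.synthesis_apply_point c))

theorem synthesis_of_finite (hg : IsDominatedSystem b g u M) (c : LInfty) (s : Finset ℕ)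
    (hs : ∀ n ∉ s, c n = 0) : hg.synthesis c = ∑ n ∈ s, c n • g n := by
  ext z
  by_cases hz : z ∈ unitDisk
  · rw [hg.synthesis_apply c hz, tsum_eq_sum (s := s) fun n hn => by simp [hs n hn]]
    simp [mul_comm]
  · rw [(hg.synthesis c).2.2.2 z hz, (∑ n ∈ s, c n • g n : HInfty).2.2.2 z hz]

theorem synthesis_eps (hg : IsDominatedSystem b g u M) (n : ℕ) :
    hg.synthesis (LInfty.eps n) = g n := by
  rw [hg.synthesis_of_finite _ {n}]
  · simp [LInfty.eps]
  · intro k hk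
    exact lp.single_apply_ne _ _ _ (by simpa using hk)

theorem circleIntegrable_norm_mul_bound (hg : IsDominatedSystem b g u M) {f : ℂ → ℂ}
    (hf : CircleIntegrable f 0 1) (k : ℕ) :
    CircleIntegrable (fun w => ‖f w‖ * u k w) 0 1 := by
  rw [circleIntegrable_iff_integrableOn] at hf ⊢
  refine hf.norm.mul_bdd (c := M) ?_ (Eventually.of_forall fun θ => ?_)
  · exact ((hg.measurable k).comp (by fun_prop)).aestronglyMeasurable
  · rw [Real.norm_of_nonneg (hg.nonneg k (by simp))]
    exact hg.bound_le k (by simp)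

/-- Integrating the pointwise bound on finite sums of `u k` against `‖f‖` bounds all partial sums by
`M` times the `L¹` norm of `f`. -/
theorem summable_circleAverage (hg : IsDominatedSystem b g u M) {f : ℂ → ℂ}
    (hf : CircleIntegrable f 0 1) :
    Summable fun k => Real.circleAverage (fun w => ‖f w‖ * u k w) 0 1 := by
  have hn : ∀ w ∈ Metric.sphere (0 : ℂ) |1|, ‖w‖ = 1 := fun w hw => by simpa using hw
  refine summable_of_sum_le (c := Real.circleAverage (fun w => ‖f w‖ * M) 0 1)
    (fun k => Real.circleAverage_nonneg_of_nonneg fun w hw =>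
      mul_nonneg (norm_nonneg _) (hg.nonneg k (hn w hw))) fun s => ?_
  rw [← Real.circleAverage_fun_sum fun k _ => hg.circleIntegrable_norm_mul_bound hf k]
  refine Real.circleAverage_mono
    (CircleIntegrable.fun_sum s fun k _ => hg.circleIntegrable_norm_mul_bound hf k)
    (IntervalIntegrable.mul_const hf.norm M) fun w hw => ?_
  rw [← Finset.mul_sum]
  gcongr
  exact hg.sum_le w (hn w hw) s

/-- The operator `c ↦ ∑ₖ cₖ gₖ` is the adjoint of an operator from `L¹/H¹₀` to `ℓ¹`. -/
theorem predual_synthesis (hg : IsDominatedSystem b g u M) {φ : HInfty → ℂ}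
    (hφ : IsPredualFunctional φ) :
    (Summable fun k => ‖φ (g k)‖) ∧ ∀ c, φ (hg.synthesis c) = ∑' k, φ (g k) * c k := by
  obtain ⟨f, hf, hφ⟩ := hφ
  have hn : ∀ w ∈ Metric.sphere (0 : ℂ) |1|, ‖w‖ = 1 := fun w hw => by simpa using hw
  -- A summable majorant, uniform in `r`. It serves both to exchange sum and integral for fixed `r`
  -- and to let `r → 1` in the resulting series.
  set U : ℕ → ℝ := fun k => Real.circleAverage (fun w => ‖f w‖ * u k w) 0 1 with hU
  have hUs : Summable U := hg.summable_circleAverage hf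
  have havn : ∀ k, ∀ r ∈ Set.Ico (0 : ℝ) 1,
      Real.circleAverage (fun w => ‖f w * (g k : ℂ → ℂ) (r * w)‖) 0 1 ≤ U k := by
    intro k r hr
    refine Real.circleAverage_mono (circleIntegrable_mul_dilate (g k) hr hf).norm
      (hg.circleIntegrable_norm_mul_bound hf k) fun w hw => ?_
    rw [norm_mul]
    gcongr
    exact hg.norm_le k w (hn w hw) r hr
  have hav : ∀ k, ∀ r ∈ Set.Ico (0 : ℝ) 1,
      ‖Real.circleAverage (fun w => f w * (g k : ℂ → ℂ) (r * w)) 0 1‖ ≤ U k := fun k r hr =>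
    norm_circleAverage_le.trans (havn k r hr)
  have hφle : ∀ k, ‖φ (g k)‖ ≤ U k := fun k =>
    le_of_tendsto (hφ (g k)).norm (eventually_mem_Ico.mono fun r hr => hav k r hr)
  refine ⟨hUs.of_nonneg_of_le (fun _ => norm_nonneg _) hφle, fun c => ?_⟩
  have hlim := tendsto_tsum_of_dominated_convergence (𝓕 := 𝓝[<] (1 : ℝ))
    (f := fun r k => Real.circleAverage (fun w => f w * (g k : ℂ → ℂ) (r * w)) 0 1 * c k)
    (g := fun k => φ (g k) * c k) (hUs.mul_right ‖c‖)
    (fun k => (hφ (g k)).mul_const _) (by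
      filter_upwards [eventually_mem_Ico] with r hr k
      rw [norm_mul]
      gcongr
      · exact (norm_nonneg _).trans (hav k r hr)
      · exact hav k r hr
      · exact c.norm_apply_le k)
  -- For each `r` in `[0, 1)` the two expressions agree by integrating the series termwise; hence so
  -- do their limits.
  refine tendsto_nhds_unique (hφ (hg.synthesis c)) (hlim.congr' ?_)
  filter_upwards [eventually_mem_Ico] with r hr
  have hint : ∀ k, CircleIntegrable (fun w => f w * (g k : ℂ → ℂ) (r * w) * c k) 0 1 := fun k =>
    IntervalIntegrable.mul_const (circleIntegrable_mul_dilate (g k) hr hf) (c k)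
  have hcongr : Set.EqOn (fun w => f w * (hg.synthesis c : ℂ → ℂ) (r * w))
      (fun w => ∑' k, f w * (g k : ℂ → ℂ) (r * w) * c k) (Metric.sphere 0 |1|) := by
    intro w hw
    simp only [mul_assoc, tsum_mul_left]
    rw [hg.synthesis_apply c (norm_ofReal_mul_lt_one hr (hn w hw))]
  rw [Real.circleAverage_congr_sphere hcongr, circleAverage_tsum hint]
  · congr 1
    ext k
    simp_rw [mul_comm _ (c k), ← smul_eq_mul (c k)]
    exact Real.circleAverage_fun_smul.symm
  · refine (hUs.mul_right ‖c‖).of_nonneg_of_le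
      (fun k => Real.circleAverage_nonneg_of_nonneg fun _ _ => norm_nonneg _) fun k => ?_
    simp_rw [norm_mul _ (c k), mul_comm _ ‖c k‖]
    rw [mul_comm]
    have := Real.circleAverage_fun_smul (a := ‖c k‖) (c := (0 : ℂ)) (R := 1)
      (f := fun w => ‖f w * (g k : ℂ → ℂ) (r * w)‖)
    simp only [smul_eq_mul] at this
    rw [this]
    gcongr
    · exact Real.circleAverage_nonneg_of_nonneg fun _ _ => norm_nonneg _
    · exact c.norm_apply_le k
    · exact havn k r hr

theorem continuous_synthesis (hg : IsDominatedSystem b g u M) :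
    Continuous[LInfty.weakStar, HInfty.weakStar] hg.synthesis :=
  continuous_iInf_rng.2 fun φ => continuous_iInf_rng.2 fun hφ => continuous_induced_rng.2 <| by
    obtain ⟨hs, h⟩ := hg.predual_synthesis hφ
    rw [show φ ∘ hg.synthesis = fun c : LInfty => ∑' k, φ (g k) * c k from funext h]
    exact LInfty.continuous_tsum_mul hs

end IsDominatedSystem

/-- The truncations of `c ∈ ℓ^∞`. -/
def LInfty.truncate (c : LInfty) (N : ℕ) : LInfty :=
  ∑ n ∈ Finset.range N, c n • LInfty.eps n

theorem LInfty.truncate_apply (c : LInfty) (N n : ℕ) :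
    c.truncate N n = if n < N then c n else 0 := by
  rw [truncate, lp.coeFn_sum, Finset.sum_apply]
  simp [LInfty.eps, Pi.single_apply]

/-- Pairing a truncation with an `ℓ¹` sequence gives a partial sum of the full pairing. Norm
convergence would fail in general. -/
theorem LInfty.tendsto_truncate (c : LInfty) :
    Tendsto c.truncate atTop (@nhds LInfty LInfty.weakStar c) := by
  simp only [nhds_iInf, nhds_induced, tendsto_iInf, tendsto_comap_iff]
  intro A
  have h := (c.summable_mul (LInfty.summable_norm A)).hasSum.tendsto_sum_nat
  refine h.congr fun N => ?_
  simp only [Function.comp_apply, LInfty.truncate_apply, mul_ite, mul_zero]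
  rw [tsum_eq_sum (s := Finset.range N) fun n hn => by simp at hn; simp [hn]]
  exact Finset.sum_congr rfl fun n hn => by simp at hn; simp [hn]

/-! ### Closedness of the range and the `ℓ^∞`-basis property -/

namespace IsDominatedSystem

open HInfty

variable {b : ℕ → ℂ} {g : ℕ → HInfty} {u : ℕ → ℂ → ℝ} {M : ℝ}

theorem tendsto_sum (hg : IsDominatedSystem b g u M) (c : LInfty) :
    Tendsto (fun N => ∑ n ∈ Finset.range N, c n • g n) atTop
      (@nhds HInfty HInfty.weakStar (hg.synthesis c)) := by
  let := HInfty.weakStar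
  let := LInfty.weakStar
  refine ((hg.continuous_synthesis.tendsto c).comp c.tendsto_truncate).congr fun N => ?_
  simp [LInfty.truncate, hg.synthesis_eps]

theorem isInterpolating (hg : IsDominatedSystem b g u M) : IsInterpolating b :=
  ⟨hg.mem_disk, fun c => ⟨hg.synthesis c, hg.synthesis_apply_point c⟩⟩

/-- The range of the synthesis operator is the fixed space of a weak* continuous projection. -/
theorem isClosed_range (hg : IsDominatedSystem b g u M) :
    IsClosed[HInfty.weakStar] (LinearMap.range hg.synthesis : Set HInfty) := by
  let := HInfty.weakStar
  let := LInfty.weakStar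
  have := t2Space_weakStar
  have : (LinearMap.range hg.synthesis : Set HInfty) =
      {h | hg.synthesis (sample b hg.mem_disk h) = h} := by
    ext h
    constructor
    · rintro ⟨c, rfl⟩
      simp only [Set.mem_ofPred_eq, hg.sample_synthesis]
    · intro h'
      exact ⟨_, h'⟩
  rw [this]
  exact isClosed_eq (hg.continuous_synthesis.comp (continuous_sample b hg.mem_disk)) continuous_id

theorem range_eq_closure (hg : IsDominatedSystem b g u M) :
    (LinearMap.range hg.synthesis : Set HInfty) =
      @closure HInfty HInfty.weakStar (Submodule.span ℂ (Set.range g) : Set HInfty) := by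
  let := HInfty.weakStar
  refine subset_antisymm ?_ (closure_minimal ?_ hg.isClosed_range)
  · rintro _ ⟨c, rfl⟩
    refine mem_closure_of_tendsto (hg.tendsto_sum c) (Eventually.of_forall fun N => ?_)
    exact Submodule.sum_mem _ fun n _ =>
      Submodule.smul_mem _ _ (Submodule.subset_span ⟨n, rfl⟩)
  · refine Submodule.span_le.2 ?_
    rintro _ ⟨n, rfl⟩
    exact ⟨_, hg.synthesis_eps n⟩

theorem isWeakStarSchauderBasis (hg : IsDominatedSystem b g u M) :
    IsWeakStarSchauderBasis (LinearMap.range hg.synthesis) g := by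
  refine ⟨fun n => ⟨_, hg.synthesis_eps n⟩, ?_⟩
  rintro _ ⟨c, rfl⟩
  refine ⟨c, hg.tendsto_sum c, fun α hα => funext fun n => ?_⟩
  -- Uniqueness: by biorthogonality, evaluating at `b n` turns the partial sums into a sequence that
  -- is eventually `α n`.
  have hev := continuous_of_isPredualFunctional (isPredualFunctional_eval (hg.mem_disk n))
  let := HInfty.weakStar
  have h1 := (hev.tendsto _).comp hα
  rw [hg.synthesis_apply_point] at h1
  refine tendsto_nhds_unique (tendsto_const_nhds.congr' ?_) h1
  filter_upwards [eventually_gt_atTop n] with N hN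
  simp [hg.biorthogonal, hN]

theorem isLInftyBasis (hg : IsDominatedSystem b g u M) :
    IsLInftyBasis (LinearMap.range hg.synthesis) g := by
  have hinj : Function.Injective hg.synthesis :=
    Function.LeftInverse.injective hg.sample_synthesis
  refine ⟨hg.isWeakStarSchauderBasis, LinearEquiv.ofInjective _ hinj, ⟨?_, ?_, ?_, ?_⟩,
    hg.synthesis_eps⟩
  · refine ⟨M, fun c => supNorm_le _ fun z hz => ?_⟩
    rw [LinearEquiv.ofInjective_apply, hg.synthesis_apply c hz]
    exact hg.norm_tsum_le c hz
  -- The entries of `c` are values of its image at the points `b n`, so the constant 1 suffices.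
  · refine ⟨1, fun c => ?_⟩
    rw [one_mul, LinearEquiv.ofInjective_apply]
    refine lp.norm_le_of_forall_le' _ fun n => ?_
    rw [← hg.synthesis_apply_point c n]
    exact norm_apply_le_supNorm _ (hg.mem_disk n)
  · exact continuous_induced_rng.2 hg.continuous_synthesis
  · have h : ⇑(LinearEquiv.ofInjective _ hinj).symm =
        fun x => sample b hg.mem_disk x.1 := by
      funext x
      obtain ⟨c, rfl⟩ := (LinearEquiv.ofInjective _ hinj).surjective x
      rw [LinearEquiv.symm_apply_apply, LinearEquiv.ofInjective_apply, hg.sample_synthesis]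
    rw [h]
    let := HInfty.weakStar
    let := LInfty.weakStar
    exact (continuous_sample b hg.mem_disk).comp continuous_induced_dom

end IsDominatedSystem

/-! ### Blaschke factors and products -/

/-- This identity gives both the bound 1 for Blaschke factors and the estimate of their distance
from 1 in modulus. -/
theorem sq_norm_one_sub_conj_mul_sub (b z : ℂ) :
    ‖1 - conj b * z‖ ^ 2 - ‖b - z‖ ^ 2 = (1 - ‖b‖ ^ 2) * (1 - ‖z‖ ^ 2) := by
  simp only [Complex.sq_norm, Complex.normSq_apply, Complex.sub_re, Complex.sub_im, Complex.mul_re,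
    Complex.mul_im, Complex.conj_re, Complex.conj_im, Complex.one_re, Complex.one_im]
  ring

theorem norm_sub_le_norm_one_sub_conj_mul {b z : ℂ} (hb : ‖b‖ ≤ 1) (hz : ‖z‖ ≤ 1) :
    ‖b - z‖ ≤ ‖1 - conj b * z‖ := by
  have h := sq_norm_one_sub_conj_mul_sub b z
  refine le_of_sq_le_sq ?_ (norm_nonneg _)
  have h1 : 0 ≤ 1 - ‖b‖ ^ 2 := by nlinarith [norm_nonneg b]
  have h2 : 0 ≤ 1 - ‖z‖ ^ 2 := by nlinarith [norm_nonneg z]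
  nlinarith [mul_nonneg h1 h2]

theorem one_sub_norm_mul_norm_le (b z : ℂ) : 1 - ‖b‖ * ‖z‖ ≤ ‖1 - conj b * z‖ := by
  have := norm_sub_norm_le (1 : ℂ) (conj b * z)
  simpa using this

theorem one_sub_conj_mul_ne_zero {b z : ℂ} (hb : b ∈ unitDisk) (hz : z ∈ unitDisk) :
    1 - conj b * z ≠ 0 := by
  have h1 : ‖b‖ < 1 := by simpa using hb
  have h2 : ‖z‖ < 1 := by simpa using hz
  have := one_sub_norm_mul_norm_le b z
  exact norm_pos_iff.1 (by nlinarith [norm_nonneg b, norm_nonneg z])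

theorem norm_blaschkeFactor (b z : ℂ) :
    ‖blaschkeFactor b z‖ = ‖b - z‖ / ‖1 - conj b * z‖ := by
  unfold blaschkeFactor
  split_ifs with h
  · simp [h]
  · simp [h]

theorem norm_blaschkeFactor_le_one {b z : ℂ} (hb : b ∈ unitDisk) (hz : z ∈ unitDisk) :
    ‖blaschkeFactor b z‖ ≤ 1 := by
  rw [norm_blaschkeFactor]
  exact div_le_one_of_le₀ (norm_sub_le_norm_one_sub_conj_mul (mem_ball_zero_iff.1 hb).le
    (mem_ball_zero_iff.1 hz).le) (norm_nonneg _)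

theorem blaschkeFactor_self (b : ℂ) : blaschkeFactor b b = 0 := by
  simp +contextual [blaschkeFactor]

theorem norm_blaschkeFactor_eq (b z : ℂ) :
    ‖blaschkeFactor b z‖ = ‖(z - b) / (1 - conj z * b)‖ := by
  have h : 1 - conj z * b = conj (1 - conj b * z) := by simp [mul_comm]
  rw [norm_blaschkeFactor, norm_div, norm_sub_rev, h, RCLike.norm_conj]

theorem differentiableOn_blaschkeFactor {b : ℂ} (hb : b ∈ unitDisk) :
    DifferentiableOn ℂ (blaschkeFactor b) unitDisk := by
  unfold blaschkeFactor
  split_ifs with h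
  · exact differentiableOn_id
  · refine DifferentiableOn.const_mul (DifferentiableOn.div (by fun_prop) (by fun_prop) ?_) _
    exact fun z hz => one_sub_conj_mul_ne_zero hb hz

theorem norm_blaschkeFactor_sub_one_le {b z : ℂ} {ρ : ℝ} (hb : b ∈ unitDisk) (hρ : ρ < 1)
    (hz : z ∈ Metric.ball (0 : ℂ) ρ) :
    ‖blaschkeFactor b z - 1‖ ≤ (1 - ‖b‖) * (2 / (1 - ρ)) := by
  have hb1 : ‖b‖ < 1 := by simpa using hb
  have hz1 : ‖z‖ < ρ := by simpa using hz
  have hρ1 : 0 < 1 - ρ := by linarith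
  rcases eq_or_ne b 0 with rfl | h0
  · have h1 : ‖z - 1‖ ≤ 2 := (norm_sub_le _ _).trans (by simp; linarith)
    have h2 : (2 : ℝ) ≤ 2 / (1 - ρ) := by
      rw [le_div_iff₀ hρ1]
      nlinarith [norm_nonneg z]
    simpa [blaschkeFactor] using h1.trans h2
  · have hd := one_sub_conj_mul_ne_zero hb (Metric.ball_subset_ball hρ.le hz)
    have hbb : conj b * b = (‖b‖ : ℂ) ^ 2 := Complex.conj_mul' b
    -- The unimodular normalization lets `1 - ‖b‖` factor out, so `∑ (1 - ‖b n‖) < ∞` gives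
    -- convergence of the product.
    have hid : blaschkeFactor b z - 1 =
        -((1 - (‖b‖ : ℂ)) * ((b + ‖b‖ * z) / (b * (1 - conj b * z)))) := by
      rw [blaschkeFactor, if_neg h0]
      rw [div_mul_div_comm, ← mul_div_assoc, ← neg_div, div_sub_one (mul_ne_zero h0 hd)]
      congr 1
      linear_combination z * hbb
    have hn1 : ‖(1 : ℂ) - (‖b‖ : ℂ)‖ = 1 - ‖b‖ := by
      rw [← Complex.ofReal_one, ← Complex.ofReal_sub, Complex.norm_real,
        Real.norm_of_nonneg (by linarith)]
    have hn2 : ‖b + ‖b‖ * z‖ ≤ ‖b‖ * 2 := by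
      refine (norm_add_le _ _).trans ?_
      rw [norm_mul, Complex.norm_real, norm_norm]
      nlinarith [norm_nonneg b, norm_nonneg z]
    have hn3 : 1 - ρ ≤ ‖1 - conj b * z‖ := by
      refine le_trans ?_ (one_sub_norm_mul_norm_le b z)
      nlinarith [norm_nonneg b, norm_nonneg z]
    have hbp : 0 < ‖b‖ := norm_pos_iff.2 h0
    rw [hid, norm_neg, norm_mul, hn1, norm_div, norm_mul]
    refine mul_le_mul_of_nonneg_left ?_ (by linarith)
    calc ‖b + ‖b‖ * z‖ / (‖b‖ * ‖1 - conj b * z‖)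
        ≤ ‖b‖ * 2 / (‖b‖ * (1 - ρ)) := by gcongr
      _ = 2 / (1 - ρ) := mul_div_mul_left _ _ hbp.ne'

theorem hasProdLocallyUniformlyOn_blaschkeFactor {b : ℕ → ℂ} (hb : ∀ n, b n ∈ unitDisk)
    (hs : Summable fun n => 1 - ‖b n‖) (k : ℕ) {ρ : ℝ} (hρ : ρ < 1) :
    HasProdLocallyUniformlyOn (fun (n : {n : ℕ // n ≠ k}) z => blaschkeFactor (b n) z)
      (blaschkeProd b k) (Metric.ball (0 : ℂ) ρ) := by
  have hsub : Metric.ball (0 : ℂ) ρ ⊆ unitDisk := Metric.ball_subset_ball hρ.le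
  have := Summable.hasProdLocallyUniformlyOn_one_add
    (f := fun (n : {n : ℕ // n ≠ k}) z => blaschkeFactor (b n) z - 1)
    (K := Metric.ball (0 : ℂ) ρ) Metric.isOpen_ball
    ((hs.comp_injective Subtype.val_injective).mul_right (2 / (1 - ρ)))
    (Eventually.of_forall fun n z hz => norm_blaschkeFactor_sub_one_le (hb n) hρ hz)
    fun n => ((differentiableOn_blaschkeFactor (hb n)).continuousOn.mono hsub).sub
      continuousOn_const
  simp only [add_sub_cancel] at this
  exact this

theorem hasProd_blaschkeFactor {b : ℕ → ℂ} (hb : ∀ n, b n ∈ unitDisk)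
    (hs : Summable fun n => 1 - ‖b n‖) (k : ℕ) {z : ℂ} (hz : z ∈ unitDisk) :
    HasProd (fun n : {n : ℕ // n ≠ k} => blaschkeFactor (b n) z) (blaschkeProd b k z) := by
  obtain ⟨ρ, hzρ, hρ⟩ := exists_between (show ‖z‖ < 1 by simpa using hz)
  exact (hasProdLocallyUniformlyOn_blaschkeFactor hb hs k hρ).hasProd (by simpa using hzρ)

theorem differentiableOn_blaschkeProd {b : ℕ → ℂ} (hb : ∀ n, b n ∈ unitDisk)
    (hs : Summable fun n => 1 - ‖b n‖) (k : ℕ) :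
    DifferentiableOn ℂ (blaschkeProd b k) unitDisk := by
  intro z hz
  obtain ⟨ρ, hzρ, hρ⟩ := exists_between (show ‖z‖ < 1 by simpa using hz)
  have hsub : Metric.ball (0 : ℂ) ρ ⊆ unitDisk := Metric.ball_subset_ball hρ.le
  have h := (hasProdLocallyUniformlyOn_blaschkeFactor hb hs k hρ).differentiableOn
    (.of_forall fun s => by
      simpa [Finset.prod_fn] using
        DifferentiableOn.finsetProd (u := s) fun n _ => (differentiableOn_blaschkeFactor (hb n)).mono hsub)
    Metric.isOpen_ball
  have hzb : Metric.ball (0 : ℂ) ρ ∈ 𝓝 z := Metric.isOpen_ball.mem_nhds (by simpa using hzρ)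
  exact (h.differentiableAt hzb).differentiableWithinAt

theorem norm_blaschkeProd_le_one {b : ℕ → ℂ} (hb : ∀ n, b n ∈ unitDisk)
    (hs : Summable fun n => 1 - ‖b n‖) (k : ℕ) {z : ℂ} (hz : z ∈ unitDisk) :
    ‖blaschkeProd b k z‖ ≤ 1 :=
  le_of_tendsto' (hasProd_blaschkeFactor hb hs k hz).norm fun _ =>
    Finset.prod_le_one (fun _ _ => norm_nonneg _) fun n _ => norm_blaschkeFactor_le_one (hb n) hz

theorem blaschkeProd_apply_of_ne {b : ℕ → ℂ} {k n : ℕ} (h : n ≠ k) :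
    blaschkeProd b k (b n) = 0 :=
  tprod_of_exists_eq_zero ⟨⟨n, h⟩, blaschkeFactor_self _⟩

theorem norm_blaschkeProd_self {b : ℕ → ℂ} (hb : ∀ n, b n ∈ unitDisk)
    (hs : Summable fun n => 1 - ‖b n‖) (k : ℕ) :
    ‖blaschkeProd b k (b k)‖ =
      ∏' j : {j : ℕ // j ≠ k}, ‖(b k - b j) / (1 - conj (b k) * b j)‖ := by
  rw [blaschkeProd, (hasProd_blaschkeFactor hb hs k (hb k)).multipliable.norm_tprod]
  exact tprod_congr fun j => norm_blaschkeFactor_eq _ _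

/-- Induction from `p + q - 1 ≤ p * q`, valid for `p, q ∈ [0, 1]`. -/
theorem one_sub_sum_le_prod {ι : Type*} (s : Finset ι) (p : ι → ℝ) (h0 : ∀ i ∈ s, 0 ≤ p i)
    (h1 : ∀ i ∈ s, p i ≤ 1) : 1 - ∑ i ∈ s, (1 - p i) ≤ ∏ i ∈ s, p i := by
  classical
  induction s using Finset.induction_on with
  | empty => simp
  | insert i s hi ih =>
    rw [Finset.sum_insert hi, Finset.prod_insert hi]
    have h2 := ih (fun j hj => h0 j (Finset.mem_insert_of_mem hj))
      fun j hj => h1 j (Finset.mem_insert_of_mem hj)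
    have h3 : ∏ j ∈ s, p j ≤ 1 := Finset.prod_le_one
      (fun j hj => h0 j (Finset.mem_insert_of_mem hj))
      fun j hj => h1 j (Finset.mem_insert_of_mem hj)
    nlinarith [h0 i (Finset.mem_insert_self i s), h1 i (Finset.mem_insert_self i s)]

theorem one_sub_tsum_le_norm_blaschkeProd_self {b : ℕ → ℂ} (hb : ∀ n, b n ∈ unitDisk)
    (hs : Summable fun n => 1 - ‖b n‖) (k : ℕ) {x : ℕ → ℝ} {S : ℝ} (hx : ∀ n, 0 ≤ x n)
    (hS : HasSum x S)
    (h : ∀ j, j ≠ k → 1 - ‖(b k - b j) / (1 - conj (b k) * b j)‖ ≤ x j) :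
    1 - S ≤ ‖blaschkeProd b k (b k)‖ := by
  refine ge_of_tendsto' (hasProd_blaschkeFactor hb hs k (hb k)).norm fun s => ?_
  refine le_trans ?_ (one_sub_sum_le_prod s _ (fun _ _ => norm_nonneg _)
    fun n _ => norm_blaschkeFactor_le_one (hb n) (hb k))
  have h1 : ∑ n ∈ s, (1 - ‖blaschkeFactor (b n) (b k)‖) ≤ ∑ n ∈ s, x n :=
    Finset.sum_le_sum fun n _ => by
      rw [norm_blaschkeFactor_eq]
      exact h n n.2
  -- The term `x k` is also counted in `S`; it is nonnegative, so this costs nothing.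
  have h2 : ∑ n ∈ s, x n ≤ S := by
    have h3 := sum_le_hasSum (s.map (Function.Embedding.subtype _)) (fun n _ => hx n) hS
    rwa [Finset.sum_map] at h3
  linarith

/-! ### The factor `(1 - |b|²) / (1 - conj b * z)` -/

theorem norm_one_sub_sq {b : ℂ} (hb : ‖b‖ ≤ 1) : ‖(1 : ℂ) - (‖b‖ : ℂ) ^ 2‖ = 1 - ‖b‖ ^ 2 := by
  rw [← Complex.ofReal_pow, ← Complex.ofReal_one, ← Complex.ofReal_sub, Complex.norm_real,
    Real.norm_of_nonneg (by nlinarith [norm_nonneg b])]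

theorem one_sub_sq_norm_le {a b : ℂ} {η : ℝ} (ha : ‖a‖ = 1) (hb : ‖b‖ ≤ 1) (hab : ‖b - a‖ ≤ η) :
    1 - ‖b‖ ^ 2 ≤ 2 * η := by
  have h1 := norm_sub_norm_le a b
  rw [norm_sub_rev, ha] at h1
  nlinarith [norm_nonneg b]

/-- The numerator is at most `2 * (1 - ‖b‖)`, the denominator at least `1 - ‖b‖`. -/
theorem norm_kernel_le_two {b z : ℂ} (hb : b ∈ unitDisk) (hz : z ∈ unitDisk) :
    ‖(1 - (‖b‖ : ℂ) ^ 2) / (1 - conj b * z)‖ ≤ 2 := by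
  have h1 : ‖b‖ < 1 := by simpa using hb
  have h2 : ‖z‖ < 1 := by simpa using hz
  rw [norm_div, norm_one_sub_sq h1.le]
  have := one_sub_norm_mul_norm_le b z
  rw [div_le_iff₀ (norm_pos_iff.2 (one_sub_conj_mul_ne_zero hb hz))]
  nlinarith [norm_nonneg b, norm_nonneg z]

theorem norm_kernel_le_of_mem_ball {a b z : ℂ} {η ρ : ℝ} (ha : ‖a‖ = 1) (hb : b ∈ unitDisk)
    (hab : ‖b - a‖ ≤ η) (hρ : ρ < 1) (hz : z ∈ Metric.ball (0 : ℂ) ρ) :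
    ‖(1 - (‖b‖ : ℂ) ^ 2) / (1 - conj b * z)‖ ≤ 2 * η / (1 - ρ) := by
  have h1 : ‖b‖ < 1 := by simpa using hb
  have h2 : ‖z‖ < ρ := by simpa using hz
  have h3 := one_sub_norm_mul_norm_le b z
  rw [norm_div, norm_one_sub_sq h1.le]
  have hη : 0 ≤ η := (norm_nonneg _).trans hab
  have : 0 < 1 - ρ := by linarith
  gcongr
  · exact one_sub_sq_norm_le ha h1.le hab
  · nlinarith [norm_nonneg b, norm_nonneg z]

/-- On a radius that ends far from `a`, the kernel of a point close to `a` is small. -/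
theorem norm_kernel_le_of_far {a b w : ℂ} {δ τ r : ℝ} (ha : ‖a‖ = 1) (hb : b ∈ unitDisk)
    (hδ : 0 < δ) (hτ0 : 0 ≤ τ) (hτ : τ ≤ 1 / 8) (hab : ‖b - a‖ ≤ δ * τ) (hw : ‖w‖ = 1)
    (hr : r ∈ Set.Ico (0 : ℝ) 1) (hwa : δ / 2 ≤ dist w a) :
    ‖(1 - (‖b‖ : ℂ) ^ 2) / (1 - conj b * (r * w))‖ ≤ 16 * τ := by
  have h1 : ‖b‖ < 1 := by simpa using hb
  have hrw : ‖(r : ℂ) * w‖ = r := by simp [hw, abs_of_nonneg hr.1]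
  rw [norm_div, norm_one_sub_sq h1.le]
  have hnum := one_sub_sq_norm_le ha h1.le hab
  have h2 : ‖w - r * w‖ = 1 - r := by
    rw [show w - r * w = ((1 - r : ℝ) : ℂ) * w by push_cast; ring, norm_mul, hw, mul_one,
      Complex.norm_real, Real.norm_of_nonneg (by linarith [hr.2])]
  -- Hence `δ / 2 ≤ ‖w - a‖ ≤ 2 * ‖a - r * w‖`. Moving from `a` to `b` costs at most `δ / 8`, which
  -- leaves `δ / 8` for the denominator against `2 * δ * τ` above.
  have h3 : 1 - r ≤ ‖a - r * w‖ := by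
    have := norm_sub_norm_le a (r * w)
    rwa [ha, hrw] at this
  have h4 : ‖w - a‖ ≤ ‖w - r * w‖ + ‖a - r * w‖ := by
    rw [norm_sub_rev a]
    exact norm_sub_le_norm_sub_add_norm_sub _ _ _
  have h5 : ‖a - r * w‖ ≤ ‖b - a‖ + ‖b - r * w‖ := by
    rw [norm_sub_rev b a]
    exact norm_sub_le_norm_sub_add_norm_sub _ _ _
  have h6 := norm_sub_le_norm_one_sub_conj_mul h1.le (z := r * w) (by rw [hrw]; exact hr.2.le)
  rw [dist_eq_norm] at hwa
  have h7 : δ * τ ≤ δ * (1 / 8) := by gcongr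
  have h8 : δ / 8 ≤ ‖1 - conj b * (r * w)‖ := by linarith
  rw [div_le_iff₀ (by linarith)]
  nlinarith [mul_le_mul_of_nonneg_left h8 hτ0]

/-- Points close to separated points of the circle are far apart in the pseudohyperbolic metric. -/
theorem one_sub_pseudohyperbolic_le {a₁ a₂ b₁ b₂ : ℂ} {δ₁ δ₂ τ₁ τ₂ : ℝ} (ha₁ : ‖a₁‖ = 1)
    (ha₂ : ‖a₂‖ = 1) (hb₁ : b₁ ∈ unitDisk) (hb₂ : b₂ ∈ unitDisk) (hδ₁ : 0 < δ₁) (hδ₂ : 0 < δ₂)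
    (hd₁ : δ₁ ≤ dist a₁ a₂) (hd₂ : δ₂ ≤ dist a₁ a₂) (hτ₁ : τ₁ ≤ 1 / 8) (hτ₂ : τ₂ ≤ 1 / 8)
    (hab₁ : ‖b₁ - a₁‖ ≤ δ₁ * τ₁) (hab₂ : ‖b₂ - a₂‖ ≤ δ₂ * τ₂) :
    1 - ‖(b₁ - b₂) / (1 - conj b₁ * b₂)‖ ≤ 16 * τ₁ * τ₂ := by
  have h1 : ‖b₁‖ < 1 := by simpa using hb₁
  have h2 : ‖b₂‖ < 1 := by simpa using hb₂
  have hid := sq_norm_one_sub_conj_mul_sub b₁ b₂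
  have hN := norm_sub_le_norm_one_sub_conj_mul h1.le h2.le
  have hD : 0 < ‖1 - conj b₁ * b₂‖ := norm_pos_iff.2 (one_sub_conj_mul_ne_zero hb₁ hb₂)
  have hn₁ := one_sub_sq_norm_le ha₁ h1.le hab₁
  have hn₂ := one_sub_sq_norm_le ha₂ h2.le hab₂
  have hp₁ : 0 ≤ 1 - ‖b₁‖ ^ 2 := by nlinarith [norm_nonneg b₁]
  have hp₂ : 0 ≤ 1 - ‖b₂‖ ^ 2 := by nlinarith [norm_nonneg b₂]
  have htri : dist a₁ a₂ ≤ ‖b₁ - a₁‖ + ‖b₁ - b₂‖ + ‖b₂ - a₂‖ := by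
    rw [← dist_eq_norm, ← dist_eq_norm, ← dist_eq_norm, dist_comm b₁ a₁]
    exact dist_triangle4 _ _ _ _
  have he₁ : δ₁ * τ₁ ≤ dist a₁ a₂ * (1 / 8) :=
    (mul_le_mul_of_nonneg_left hτ₁ hδ₁.le).trans (by gcongr)
  have he₂ : δ₂ * τ₂ ≤ dist a₁ a₂ * (1 / 8) :=
    (mul_le_mul_of_nonneg_left hτ₂ hδ₂.le).trans (by gcongr)
  rw [norm_div]
  set N := ‖b₁ - b₂‖
  set D := ‖1 - conj b₁ * b₂‖
  -- Each point moves by at most an eighth of `dist a₁ a₂`, so `N`, and with it `D`, is at least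
  -- three quarters of that distance.
  have hD₁ : δ₁ / 2 ≤ D := by linarith
  have hD₂ : δ₂ / 2 ≤ D := by linarith
  have hτ₁0 : 0 ≤ τ₁ := nonneg_of_mul_nonneg_right ((norm_nonneg _).trans hab₁) hδ₁
  have hτ₂0 : 0 ≤ τ₂ := nonneg_of_mul_nonneg_right ((norm_nonneg _).trans hab₂) hδ₂
  have hDD : δ₁ / 2 * (δ₂ / 2) ≤ D * D := mul_le_mul hD₁ hD₂ (by positivity) hD.le
  have hprod : (1 - ‖b₁‖ ^ 2) * (1 - ‖b₂‖ ^ 2) ≤ 16 * τ₁ * τ₂ * (D * D) := by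
    calc (1 - ‖b₁‖ ^ 2) * (1 - ‖b₂‖ ^ 2) ≤ (2 * (δ₁ * τ₁)) * (2 * (δ₂ * τ₂)) :=
          mul_le_mul hn₁ hn₂ hp₂ (by positivity)
      _ = 16 * τ₁ * τ₂ * (δ₁ / 2 * (δ₂ / 2)) := by ring
      _ ≤ _ := by gcongr
  have hND : N / D ≤ 1 := div_le_one_of_le₀ hN hD.le
  have hND0 : 0 ≤ N / D := by positivity
  -- The square is what the identity controls; `1 - x ≤ 1 - x ^ 2` on `[0, 1]` then removes it.
  have hsq : 1 - (N / D) ^ 2 ≤ 16 * τ₁ * τ₂ := by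
    rw [div_pow, one_sub_div (by positivity), hid, div_le_iff₀ (by positivity), sq D]
    exact hprod
  nlinarith

/-! ### Sequences in the disk close to separated sequences on the circle -/

/-- The function `g_k` as an element of `H^∞`. -/
def gHInfty (b : ℕ → ℂ) (hb : ∀ n, b n ∈ unitDisk) (hs : Summable fun n => 1 - ‖b n‖) (k : ℕ) :
    HInfty :=
  ⟨unitDisk.indicator (gFun b k), by
    refine DifferentiableOn.congr (f := gFun b k) ?_ fun z hz => Set.indicator_of_mem hz _
    unfold gFun
    refine DifferentiableOn.mul (DifferentiableOn.div (by fun_prop) (by fun_prop) ?_)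
      ((differentiableOn_blaschkeProd hb hs k).div_const _)
    exact fun z hz => one_sub_conj_mul_ne_zero (hb k) hz,
  ⟨2 * (1 / ‖blaschkeProd b k (b k)‖), fun z hz => by
    rw [Set.indicator_of_mem hz, gFun, norm_mul, norm_div (blaschkeProd b k z)]
    gcongr
    · exact norm_kernel_le_two (hb k) hz
    · exact norm_blaschkeProd_le_one hb hs k hz⟩,
  fun z hz => Set.indicator_of_notMem hz _⟩

theorem gHInfty_apply {b : ℕ → ℂ} (hb : ∀ n, b n ∈ unitDisk) (hs : Summable fun n => 1 - ‖b n‖)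
    (k : ℕ) {z : ℂ} (hz : z ∈ unitDisk) : (gHInfty b hb hs k : ℂ → ℂ) z = gFun b k z :=
  Set.indicator_of_mem hz (gFun b k)

theorem norm_gFun_le {b : ℕ → ℂ} (hb : ∀ n, b n ∈ unitDisk) (hs : Summable fun n => 1 - ‖b n‖)
    {m : ℝ} (hm : 0 < m) {k : ℕ} (hk : m ≤ ‖blaschkeProd b k (b k)‖) {z : ℂ} (hz : z ∈ unitDisk)
    {C : ℝ} (hC : ‖(1 - (‖b k‖ : ℂ) ^ 2) / (1 - conj (b k) * z)‖ ≤ C) :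
    ‖gFun b k z‖ ≤ C * (1 / m) := by
  rw [gFun, norm_mul, norm_div (blaschkeProd b k z)]
  gcongr
  · exact (norm_nonneg _).trans hC
  · exact norm_blaschkeProd_le_one hb hs k hz

theorem gFun_apply_point {b : ℕ → ℂ} (hb : ∀ n, b n ∈ unitDisk) (k n : ℕ)
    (hk : blaschkeProd b k (b k) ≠ 0) : gFun b k (b n) = if n = k then 1 else 0 := by
  unfold gFun
  split_ifs with h
  · subst h
    have h1 := one_sub_conj_mul_ne_zero (hb n) (hb n)
    rw [Complex.conj_mul'] at h1 ⊢
    rw [div_self h1, div_self hk, one_mul]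
  · rw [blaschkeProd_apply_of_ne h, zero_div, mul_zero]

/-- At most one term is nonzero: two would give `dist (a i) (a j) < (δ i + δ j) / 2`, although both
`δ i` and `δ j` are at most this distance. -/
theorem sum_ite_dist_le {a : ℕ → ℂ} {δ : ℕ → ℝ} (hδ : ∀ n j, j ≠ n → δ n ≤ dist (a n) (a j))
    {C : ℝ} (hC : 0 ≤ C) (w : ℂ) (s : Finset ℕ) :
    ∑ k ∈ s, (if dist w (a k) < δ k / 2 then C else 0) ≤ C := by
  rw [← Finset.sum_filter, Finset.sum_const, nsmul_eq_mul]
  have h1 : (s.filter fun k => dist w (a k) < δ k / 2).card ≤ 1 := by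
    refine Finset.card_le_one.2 fun i hi j hj => ?_
    rw [Finset.mem_filter] at hi hj
    by_contra hij
    have h2 := hδ i j (Ne.symm hij)
    have h3 := hδ j i hij
    have h4 := dist_triangle_left (a i) (a j) w
    rw [dist_comm (a j)] at h3
    linarith [hi.2, hj.2]
  have h2 : ((s.filter fun k => dist w (a k) < δ k / 2).card : ℝ) ≤ 1 := by exact_mod_cast h1
  nlinarith

/-- The majorant is the trivial bound 2 near `a k` plus the far bound `16 * τ k`, divided by the
lower bound `m` of `|B_k(b_k)|`. No uniform separation is needed, since closeness to `a k` is
measured in units of `δ k`. -/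
theorem isDominatedSystem_gHInfty {a b : ℕ → ℂ} {δ τ : ℕ → ℝ} {m : ℝ} (ha : ∀ n, ‖a n‖ = 1)
    (hb : ∀ n, b n ∈ unitDisk) (hs : Summable fun n => 1 - ‖b n‖) (hδ0 : ∀ n, 0 < δ n)
    (hδ : ∀ n j, j ≠ n → δ n ≤ dist (a n) (a j)) (hτ0 : ∀ n, 0 ≤ τ n) (hτ : ∀ n, τ n ≤ 1 / 8)
    (hτs : Summable τ) (hab : ∀ n, ‖b n - a n‖ ≤ δ n * τ n) (hm : 0 < m)
    (hB : ∀ k, m ≤ ‖blaschkeProd b k (b k)‖) :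
    IsDominatedSystem b (gHInfty b hb hs)
      (fun k w => ((if dist w (a k) < δ k / 2 then 2 else 0) + 16 * τ k) * (1 / m))
      ((2 + 16 * ∑' k, τ k) * (1 / m)) where
  mem_disk := hb
  biorthogonal k n := by
    rw [gHInfty_apply hb hs k (hb n)]
    exact gFun_apply_point hb k n (norm_pos_iff.1 (hm.trans_le (hB k)))
  measurable k := by
    refine Measurable.mul_const (Measurable.add_const (Measurable.ite ?_ ?_ ?_) _) _
    · exact measurableSet_lt (by fun_prop) (by fun_prop)
    · exact measurable_const
    · exact measurable_const
  norm_le k w hw r hr := by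
    have hz := norm_ofReal_mul_lt_one hr hw
    rw [gHInfty_apply hb hs k hz]
    refine norm_gFun_le hb hs hm (hB k) hz ?_
    split_ifs with h
    · have := norm_kernel_le_two (hb k) hz
      linarith [hτ0 k]
    · rw [zero_add]
      exact norm_kernel_le_of_far (ha k) (hb k) (hδ0 k) (hτ0 k) (hτ k) (hab k) hw hr (not_lt.1 h)
  sum_le w _ s := by
    rw [← Finset.sum_mul, Finset.sum_add_distrib, ← Finset.mul_sum]
    gcongr
    · exact sum_ite_dist_le hδ zero_le_two w s
    · exact hτs.sum_le_tsum s fun n _ => hτ0 n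
  exists_summable ρ hρ := by
    have hρ1 : 0 < 1 - ρ := by linarith
    -- Any other index would do in place of `k + 1`: two points of the circle are at distance at
    -- most 2.
    have hδ2 : ∀ k, δ k ≤ 2 := fun k => by
      refine (hδ k (k + 1) (by omega)).trans ((dist_le_norm_add_norm _ _).trans ?_)
      rw [ha, ha]
      norm_num
    refine ⟨fun k => 2 * (2 * τ k) / (1 - ρ) * (1 / m),
      (((hτs.mul_left 2).mul_left 2).div_const _).mul_right _, fun k z hz => ?_⟩
    have hzd : z ∈ unitDisk := Metric.ball_subset_ball hρ.le hz
    rw [gHInfty_apply hb hs k hzd]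
    refine norm_gFun_le hb hs hm (hB k) hzd (norm_kernel_le_of_mem_ball (ha k) (hb k) ?_ hρ hz)
    exact (hab k).trans (mul_le_mul_of_nonneg_right (hδ2 k) (hτ0 k))

theorem summable_one_sub_norm {a b : ℕ → ℂ} {η : ℕ → ℝ} (ha : ∀ n, ‖a n‖ = 1)
    (hb : ∀ n, b n ∈ unitDisk) (hη : Summable η) (hab : ∀ n, ‖b n - a n‖ ≤ η n) :
    Summable fun n => 1 - ‖b n‖ := by
  refine hη.of_nonneg_of_le (fun n => ?_) fun n => ?_
  · have := mem_ball_zero_iff.1 (hb n)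
    linarith
  · have h := norm_sub_norm_le (a n) (b n)
    rw [ha, norm_sub_rev] at h
    exact h.trans (hab n)

end

/-! ### Choice of the radii and conclusion -/

theorem mainTheorem4 (a : ℕ → ℂ) (ha : ∀ n, ‖a n‖ = 1) (hsep : IsSeparatedSeq a)
    (m : ℝ) (hm0 : 0 < m) (hm1 : m < 1) :
    ∃ η : ℕ → ℝ, (∀ n, 0 < η n) ∧
      ∀ b : ℕ → ℂ, (∀ n, b n ∈ unitDisk) → (∀ n, ‖b n - a n‖ < η n) →
        IsInterpolating b ∧ m ≤ carlesonConstant b ∧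
        (∀ k, ∀ z ∈ unitDisk,
          Multipliable (fun n : {n : ℕ // n ≠ k} => blaschkeFactor (b n) z)) ∧
        (∀ k, blaschkeProd b k (b k) ≠ 0) ∧
        ∃ g : ℕ → HInfty, (∀ k, ∀ z ∈ unitDisk, (g k : ℂ → ℂ) z = gFun b k z) ∧
          ∃ E : Submodule ℂ HInfty,
            (E : Set HInfty) =
              @closure HInfty HInfty.weakStar (Submodule.span ℂ (Set.range g) : Set HInfty) ∧
            IsLInftyBasis E g := by
  choose δ hδ0 hδ using hsep
  -- The total defect is at most `16 * τ k * (t * 2) ≤ 32 * t ^ 2 = (1 - m) * t ≤ 1 - m`; also `t ≤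
  -- 1 / 32` gives `τ n ≤ 1 / 8`.
  set t : ℝ := (1 - m) / 32 with ht
  have ht0 : 0 < t := by rw [ht]; linarith
  have ht1 : t ≤ 1 / 32 := by rw [ht]; linarith
  set τ : ℕ → ℝ := fun n => t * (1 / 2) ^ n with hτdef
  have hτ0 : ∀ n, 0 < τ n := fun n => by positivity
  have hτt : ∀ n, τ n ≤ t := fun n =>
    mul_le_of_le_one_right ht0.le (pow_le_one₀ (by norm_num) (by norm_num))
  have hτ : ∀ n, τ n ≤ 1 / 8 := fun n => (hτt n).trans (by linarith)
  have hτsum : HasSum τ (t * 2) := hasSum_geometric_two.mul_left t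
  refine ⟨fun n => δ n * τ n, fun n => mul_pos (hδ0 n) (hτ0 n), fun b hb hab' => ?_⟩
  have hab : ∀ n, ‖b n - a n‖ ≤ δ n * τ n := fun n => (hab' n).le
  have hs : Summable fun n => 1 - ‖b n‖ := by
    refine summable_one_sub_norm ha hb (hτsum.summable.mul_left 2) fun n => (hab n).trans ?_
    refine mul_le_mul_of_nonneg_right ?_ (hτ0 n).le
    refine (hδ n (n + 1) (by omega)).trans ((dist_le_norm_add_norm _ _).trans ?_)
    rw [ha, ha]
    norm_num
  have hB : ∀ k, m ≤ ‖blaschkeProd b k (b k)‖ := by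
    intro k
    have h := one_sub_tsum_le_norm_blaschkeProd_self hb hs k
      (fun n => mul_nonneg (mul_nonneg (by norm_num) (hτ0 k).le) (hτ0 n).le)
      (hτsum.mul_left (16 * τ k)) fun j hj =>
        one_sub_pseudohyperbolic_le (ha k) (ha j) (hb k) (hb j) (hδ0 k) (hδ0 j) (hδ k j hj)
          (by rw [dist_comm]; exact hδ j k hj.symm) (hτ k) (hτ j) (hab k) (hab j)
    refine le_trans ?_ h
    nlinarith [hτt k, hτ0 k]
  have hg := isDominatedSystem_gHInfty ha hb hs hδ0 hδ (fun n => (hτ0 n).le) hτ hτsum.summable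
    hab hm0 hB
  exact ⟨hg.isInterpolating,
    le_ciInf fun k => (hB k).trans_eq (norm_blaschkeProd_self hb hs k),
    fun k z hz => (hasProd_blaschkeFactor hb hs k hz).multipliable,
    fun k => norm_pos_iff.1 (hm0.trans_le (hB k)),
    gHInfty b hb hs, fun k z hz => gHInfty_apply hb hs k hz,
    _, hg.range_eq_closure, hg.isLInftyBasis⟩
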